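/- Let $d\ge 1$ and $K\ge 2$ be integers and let $S_1,\dots,S_K$ be nonsingular real $d\times d$ matrices. For $x_0\in\mathbb{R}^d$ and a switching law $\sigma\colon\{1,2,\dots\}\to\{1,\dots,K\}$ let $$x_n(x_0,\sigma)=S_{\sigma(n)}\cdots S_{\sigma(1)}x_0\qquad(n\ge 1),$$ and let $\|\cdot\|$ be the Euclidean norm. Call $\sigma$ fiber-chaotic if $$\liminf_{n\to\infty}\|x_n(x_0,\sigma)\|=0\quad\text{and}\quad\limsup_{n\to\infty}\|x_n(x_0,\sigma)\|=\infty\qquad\text{for all }x_0\in\mathbb{R}^d\setminus\{0\}.$$ For $x_0\neq 0$, whenever the limit exists in $[-\infty,\infty)$, the number $$\lambda(x_0,\sigma)=\lim_{n\to\infty}\frac1n\log\|x_n(x_0,\sigma)\|$$ is called the Lyapunov exponent at the data $(x_0,\sigma)$. Suppose that there is a fiber-chaotic switching law. Then: 1. there are $x_0\in\mathbb{R}^d\setminus\{0\}$ and a switching law $\sigma$ such that $\lambda(x_0,\sigma)$ exists and $\lambda(x_0,\sigma)>0$; 2. there are $x_0\in\mathbb{R}^d\setminus\{0\}$ and a switching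 law $\sigma$ such that $\lambda(x_0,\sigma)$ exists and $\lambda(x_0,\sigma)<0$; 3. for every $x_0\in\mathbb{R}^d\setminus\{0\}$ there is a switching law $\sigma$ such that $\lambda(x_0,\sigma)$ exists and $\lambda(x_0,\sigma)=0$. -/

import Mathlib

open Filter Topology

/-- The state trajectory `x_n(x₀, σ)` of the linear inclusion `x_n ∈ {S_k x_{n-1}}` governed by the
switching law `σ`, in `ℝ^d` with its Euclidean norm. The law is indexed from `0`, so `σ n` is the
letter used to pass from `x_n` to `x_{n+1}`, and `x_n = S_{σ (n-1)} ⋯ S_{σ 0} x₀`. -/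
noncomputable def trajectory {d K : ℕ} (S : Fin K → Matrix (Fin d) (Fin d) ℝ)
    (x₀ : EuclideanSpace ℝ (Fin d)) (σ : ℕ → Fin K) : ℕ → EuclideanSpace ℝ (Fin d)
  | 0 => x₀
  | n + 1 => Matrix.toEuclideanLin (S (σ n)) (trajectory S x₀ σ n)

/-- `σ` is fiber-chaotic: for every nonzero initial state, `liminf ‖x_n‖ = 0` and
`limsup ‖x_n‖ = ∞`, both computed in `[0, ∞]`. -/
def IsFiberChaotic {d K : ℕ} (S : Fin K → Matrix (Fin d) (Fin d) ℝ) (σ : ℕ → Fin K) : Prop :=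
  ∀ x₀ : EuclideanSpace ℝ (Fin d), x₀ ≠ 0 →
    liminf (fun n => ‖trajectory S x₀ σ n‖ₑ) atTop = 0 ∧
    limsup (fun n => ‖trajectory S x₀ σ n‖ₑ) atTop = ⊤

/-- The limit of `(1/n) log ‖x_n(x₀, σ)‖` exists in the extended reals and equals `l`. Here `log` is
the extended logarithm, with `log 0 = -∞`. -/
def HasLyapunovExponent {d K : ℕ} (S : Fin K → Matrix (Fin d) (Fin d) ℝ)
    (x₀ : EuclideanSpace ℝ (Fin d)) (σ : ℕ → Fin K) (l : EReal) : Prop :=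
  Tendsto (fun n : ℕ => ENNReal.log ‖trajectory S x₀ σ n‖ₑ / (n : EReal)) atTop (𝓝 l)

/-! A fiber-chaotic law, restarted at any nonzero state, at some time halves the norm and at some
time doubles it. By homogeneity and compactness of the unit sphere, both happen within a common time
`N`. Restarting the law at will therefore gives feedback control of `log ‖x_n‖`: above a target
line, run it until the norm has halved; below, until it has doubled. If the slope `l` satisfies `|l|
≤ log 2 / N`, the error stays bounded (`IsFiberChaotic.exists_steering`), so the exponent is `l`.
Small positive, negative and zero slopes give the three claims. -/

section Steering

variable {d K : ℕ} {S : Fin K → Matrix (Fin d) (Fin d) ℝ}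

/-- Peels off the first letter, where the definition peels off the last; needed to consume a planned
word letter by letter. -/
theorem trajectory_succ' (x : EuclideanSpace ℝ (Fin d)) (σ : ℕ → Fin K) (n : ℕ) :
    trajectory S x σ (n + 1) =
      trajectory S (Matrix.toEuclideanLin (S (σ 0)) x) (fun i => σ (i + 1)) n := by
  induction n with
  | zero => rfl
  | succ n ih => rw [trajectory, ih]; rfl

theorem trajectory_smul (x : EuclideanSpace ℝ (Fin d)) (σ : ℕ → Fin K) (c : ℝ) (n : ℕ) :
    trajectory S (c • x) σ n = c • trajectory S x σ n := by
  induction n with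
  | zero => rfl
  | succ n ih => rw [trajectory, ih, map_smul]; rfl

theorem continuous_trajectory (σ : ℕ → Fin K) (n : ℕ) :
    Continuous fun x => trajectory S x σ n := by
  induction n with
  | zero => exact continuous_id
  | succ n ih => exact (LinearMap.continuous_of_finiteDimensional _).comp ih

theorem trajectory_ne_zero (hS : ∀ k, (S k).det ≠ 0) {x : EuclideanSpace ℝ (Fin d)} (hx : x ≠ 0)
    (σ : ℕ → Fin K) (n : ℕ) : trajectory S x σ n ≠ 0 := by
  induction n with
  | zero => exact hx
  | succ n ih =>
    intro h
    have h' := congrArg (WithLp.ofLp) h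
    have : (S (σ n)).mulVec (trajectory S x σ n).ofLp = 0 := h'
    have h0 := Matrix.eq_zero_of_mulVec_eq_zero (hS _) this
    exact ih (by ext i; exact congrFun h0 i)

/-- One step changes the logarithm of the norm by a bounded amount. -/
theorem exists_log_norm_step_bound (hS : ∀ k, (S k).det ≠ 0) :
    ∃ M : ℝ, 0 ≤ M ∧ ∀ (k : Fin K) (x : EuclideanSpace ℝ (Fin d)), x ≠ 0 →
      |Real.log ‖Matrix.toEuclideanLin (S k) x‖ - Real.log ‖x‖| ≤ M := by
  have hcont (k : Fin K) : ContinuousOn (fun x : EuclideanSpace ℝ (Fin d) =>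
      |Real.log ‖Matrix.toEuclideanLin (S k) x‖|) (Metric.sphere 0 1) := by
    refine (ContinuousOn.log ?_ ?_).abs
    · exact (LinearMap.continuous_of_finiteDimensional _).norm.continuousOn
    · intro x hx
      have hx0 : x ≠ 0 := by rintro rfl; simp at hx
      exact norm_ne_zero_iff.2 (trajectory_ne_zero hS hx0 (fun _ => k) 1)
  have hbound (k : Fin K) : ∃ C : ℝ, ∀ x ∈ Metric.sphere (0 : EuclideanSpace ℝ (Fin d)) 1,
      |Real.log ‖Matrix.toEuclideanLin (S k) x‖| ≤ C := by
    obtain ⟨C, hC⟩ := (isCompact_sphere _ _).exists_bound_of_continuousOn (hcont k)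
    exact ⟨C, fun x hx => by simpa using hC x hx⟩
  choose C hC using hbound
  refine ⟨∑ k, |C k|, Finset.sum_nonneg fun k _ => abs_nonneg _, fun k x hx => ?_⟩
  have hn : ‖x‖ ≠ 0 := norm_ne_zero_iff.2 hx
  have h := hC k (‖x‖⁻¹ • x) (by simp [norm_smul, hn])
  have hne : ‖Matrix.toEuclideanLin (S k) x‖ ≠ 0 :=
    norm_ne_zero_iff.2 (trajectory_ne_zero hS hx (fun _ => k) 1)
  rw [map_smul, norm_smul, Real.log_mul (by simpa using hx) hne, norm_inv, norm_norm,
    Real.log_inv, neg_add_eq_sub] at h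
  exact h.trans ((le_abs_self _).trans
    (Finset.single_le_sum (f := fun k => |C k|) (fun k _ => abs_nonneg _) (Finset.mem_univ k)))

theorem abs_log_norm_trajectory_sub_le (hS : ∀ k, (S k).det ≠ 0) {M : ℝ}
    (hM : ∀ (k : Fin K) (x : EuclideanSpace ℝ (Fin d)), x ≠ 0 →
      |Real.log ‖Matrix.toEuclideanLin (S k) x‖ - Real.log ‖x‖| ≤ M)
    {x : EuclideanSpace ℝ (Fin d)} (hx : x ≠ 0) (σ : ℕ → Fin K) (n : ℕ) :
    |Real.log ‖trajectory S x σ n‖ - Real.log ‖x‖| ≤ n * M := by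
  induction n with
  | zero => simp [trajectory]
  | succ n ih =>
    have h := hM (σ n) _ (trajectory_ne_zero hS hx σ n)
    rw [trajectory]
    push_cast
    rw [abs_le] at *
    constructor <;> linarith [h.1, h.2, ih.1, ih.2]

/-- If open conditions on the direction are each met at some time, then they are met within a
uniformly bounded time. -/
theorem exists_uniform_time {σ : ℕ → Fin K} {I : Set ℝ} (hI : IsOpen I)
    (h : ∀ x : EuclideanSpace ℝ (Fin d), x ≠ 0 → ∃ n, ‖trajectory S x σ n‖ ∈ I) :
    ∃ N : ℕ, ∀ x : EuclideanSpace ℝ (Fin d), x ≠ 0 →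
      ∃ n ≤ N, ‖x‖⁻¹ * ‖trajectory S x σ n‖ ∈ I := by
  obtain ⟨t, ht⟩ := (isCompact_sphere (0 : EuclideanSpace ℝ (Fin d)) 1).elim_finite_subcover
    (fun n => {x | ‖trajectory S x σ n‖ ∈ I})
    (fun n => hI.preimage (continuous_trajectory σ n).norm)
    (fun x hx => Set.mem_iUnion.2 (h x (by rintro rfl; simp at hx)))
  refine ⟨t.sup id, fun x hx => ?_⟩
  have hn : ‖x‖ ≠ 0 := norm_ne_zero_iff.2 hx
  have hmem := ht (show ‖x‖⁻¹ • x ∈ Metric.sphere 0 1 by simp [norm_smul, hn])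
  simp only [Set.mem_iUnion, Set.mem_ofPred_eq, trajectory_smul, norm_smul, norm_inv,
    norm_norm] at hmem
  obtain ⟨n, hnt, hnI⟩ := hmem
  exact ⟨n, Finset.le_sup (f := id) hnt, hnI⟩

theorem IsFiberChaotic.exists_uniform_halving_doubling (hS : ∀ k, (S k).det ≠ 0)
    {σ : ℕ → Fin K} (hσ : IsFiberChaotic S σ) :
    ∃ N : ℕ, 0 < N ∧ ∀ x : EuclideanSpace ℝ (Fin d), x ≠ 0 →
      (∃ n ≤ N, Real.log ‖trajectory S x σ n‖ ≤ Real.log ‖x‖ - Real.log 2) ∧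
      (∃ n ≤ N, Real.log ‖x‖ + Real.log 2 ≤ Real.log ‖trajectory S x σ n‖) := by
  obtain ⟨N₁, h₁⟩ := exists_uniform_time (S := S) (σ := σ) (I := Set.Iio (1 / 2)) isOpen_Iio <| by
    intro x hx
    have hlt : liminf (fun n => ‖trajectory S x σ n‖ₑ) atTop < ENNReal.ofReal (1 / 2) := by
      rw [(hσ x hx).1]; simp
    obtain ⟨n, hn⟩ := (frequently_lt_of_liminf_lt (by isBoundedDefault) hlt).exists
    refine ⟨n, ?_⟩
    rw [← ofReal_norm] at hn
    exact (ENNReal.ofReal_lt_ofReal_iff (by norm_num)).1 hn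
  obtain ⟨N₂, h₂⟩ := exists_uniform_time (S := S) (σ := σ) (I := Set.Ioi 2) isOpen_Ioi <| by
    intro x hx
    have hlt : ENNReal.ofReal 2 < limsup (fun n => ‖trajectory S x σ n‖ₑ) atTop := by
      rw [(hσ x hx).2]; simp
    obtain ⟨n, hn⟩ := (frequently_lt_of_lt_limsup (by isBoundedDefault) hlt).exists
    refine ⟨n, ?_⟩
    rw [← ofReal_norm] at hn
    exact (ENNReal.ofReal_lt_ofReal_iff_of_nonneg (by norm_num)).1 hn
  refine ⟨max N₁ N₂ + 1, by omega, fun x hx => ⟨?_, ?_⟩⟩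
  · obtain ⟨n, hn, h⟩ := h₁ x hx
    refine ⟨n, by omega, ?_⟩
    have hx' : 0 < ‖x‖ := norm_pos_iff.2 hx
    have hy : 0 < ‖trajectory S x σ n‖ := norm_pos_iff.2 (trajectory_ne_zero hS hx σ n)
    have := Real.log_le_log (mul_pos (inv_pos.2 hx') hy) (le_of_lt h)
    rw [Real.log_mul (inv_pos.2 hx').ne' hy.ne', Real.log_inv, one_div, Real.log_inv] at this
    linarith
  · obtain ⟨n, hn, h⟩ := h₂ x hx
    refine ⟨n, by omega, ?_⟩
    have hx' : 0 < ‖x‖ := norm_pos_iff.2 hx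
    have hy : 0 < ‖trajectory S x σ n‖ := norm_pos_iff.2 (trajectory_ne_zero hS hx σ n)
    have := Real.log_le_log two_pos (le_of_lt h)
    rw [Real.log_mul (inv_pos.2 hx').ne' hy.ne', Real.log_inv] at this
    linarith

/-- A condition on the time and the state that can always be maintained for one more step is
maintained forever by some switching law. -/
theorem exists_law_of_viable {P : ℕ → EuclideanSpace ℝ (Fin d) → Prop}
    (hP : ∀ n x, P n x → ∃ k, P (n + 1) (Matrix.toEuclideanLin (S k) x))
    {x₀ : EuclideanSpace ℝ (Fin d)} (h₀ : P 0 x₀) :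
    ∃ σ : ℕ → Fin K, ∀ n, P n (trajectory S x₀ σ n) := by
  have : Nonempty (Fin K) := ⟨(hP 0 x₀ h₀).choose⟩
  choose! f hf using hP
  let y : ℕ → EuclideanSpace ℝ (Fin d) :=
    Nat.rec x₀ fun n x => Matrix.toEuclideanLin (S (f n x)) x
  have hy (n : ℕ) : trajectory S x₀ (fun n => f n (y n)) n = y n := by
    induction n with
    | zero => rfl
    | succ n ih => rw [trajectory, ih]
  refine ⟨fun n => f n (y n), fun n => ?_⟩
  rw [hy]
  induction n with
  | zero => exact h₀
  | succ n ih => exact hf n (y n) ih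

/-- Along a suitable law, `log ‖x_n‖` follows any line through `log ‖x₀‖` of small slope up to a
bounded error. -/
theorem IsFiberChaotic.exists_steering (hS : ∀ k, (S k).det ≠ 0)
    {σ : ℕ → Fin K} (hσ : IsFiberChaotic S σ) :
    ∃ ε : ℝ, 0 < ε ∧ ∀ l : ℝ, |l| ≤ ε → ∀ x₀ : EuclideanSpace ℝ (Fin d), x₀ ≠ 0 →
      ∃ τ : ℕ → Fin K, ∃ C : ℝ, ∀ n : ℕ, |Real.log ‖trajectory S x₀ τ n‖ - n * l| ≤ C := by
  obtain ⟨M, hM0, hM⟩ := exists_log_norm_step_bound hS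
  obtain ⟨N, hN, hword⟩ := hσ.exists_uniform_halving_doubling hS
  have hN' : (0 : ℝ) < N := by exact_mod_cast hN
  have hlog2 : 0 < Real.log 2 := Real.log_pos one_lt_two
  -- At such a slope the target moves by at most `log 2` during `N` steps, no more than one halving
  -- or doubling compensates.
  refine ⟨Real.log 2 / N, by positivity, fun l hl x₀ hx₀ => ?_⟩
  have hdrift (m : ℕ) (hm : m ≤ N) : |m * l| ≤ Real.log 2 ∧ m * M ≤ N * M := by
    have hm' : (m : ℝ) ≤ N := by exact_mod_cast hm
    refine ⟨?_, by gcongr⟩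
    rw [abs_mul, Nat.abs_cast]
    calc (m : ℝ) * |l| ≤ N * (Real.log 2 / N) := by gcongr
      _ = Real.log 2 := by field_simp
  set B : ℝ := N * M + Real.log 2 + |Real.log ‖x₀‖| with hB
  obtain ⟨τ, hτ⟩ := exists_law_of_viable (S := S) (x₀ := x₀)
    -- The invariant is a plan: the first `m` letters of `ω` are still to be played, and the error
    -- is at most `B` once they are.
    (P := fun n x => x ≠ 0 ∧ ∃ m ≤ N, ∃ ω : ℕ → Fin K,
      |Real.log ‖trajectory S x ω m‖ - (n + m) * l| ≤ B)
    (by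
      rintro n x ⟨hx, hP⟩
      have key : ∃ m < N, ∃ ω : ℕ → Fin K,
          |Real.log ‖trajectory S x ω (m + 1)‖ - (n + (m + 1 : ℕ)) * l| ≤ B := by
        obtain ⟨m, hm, ω, h⟩ := hP
        -- With no letters left, a new plan is made from the current state according to the sign of
        -- the error.
        rcases m with _ | m
        swap
        · exact ⟨m, hm, ω, h⟩
        simp only [trajectory, Nat.cast_zero, add_zero] at h
        obtain ⟨⟨p, hp, hpl⟩, q, hq, hql⟩ := hword x hx
        have hx0 := abs_nonneg (Real.log ‖x₀‖)
        rcases le_total 0 (Real.log ‖x‖ - n * l) with he | he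
        -- A halving word cannot be empty, since `log 2 > 0`.
        · rcases p with _ | p
          · simp only [trajectory] at hpl
            linarith
          refine ⟨p, hp, σ, ?_⟩
          have h1 := abs_le.1 (abs_log_norm_trajectory_sub_le hS hM hx σ (p + 1))
          -- The upper error does not grow; the lower one, starting from a nonnegative error, is at
          -- least `-(N * M + log 2)`, which is why `B` contains these terms.
          obtain ⟨h2, h3⟩ := hdrift _ hp
          rw [abs_le] at h2 h ⊢
          constructor <;> linarith
        · rcases q with _ | q
          · simp only [trajectory] at hql
            linarith
          refine ⟨q, hq, σ, ?_⟩
          have h1 := abs_le.1 (abs_log_norm_trajectory_sub_le hS hM hx σ (q + 1))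
          obtain ⟨h2, h3⟩ := hdrift _ hq
          rw [abs_le] at h2 h ⊢
          constructor <;> linarith
      obtain ⟨m, hm, ω, h⟩ := key
      refine ⟨ω 0, trajectory_ne_zero hS hx ω 1, m, hm.le, fun i => ω (i + 1), ?_⟩
      rw [trajectory_succ'] at h
      push_cast at h ⊢
      rwa [show (n : ℝ) + 1 + m = n + (m + 1) by ring])
    ⟨hx₀, 0, Nat.zero_le _, σ, by
      simp only [trajectory, Nat.cast_zero, add_zero, zero_mul, sub_zero, hB]
      have : 0 ≤ N * M := by positivity
      linarith⟩
  -- In the middle of a plan, the error differs from its value at the end of the plan by at most `N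
  -- * M + log 2`.
  refine ⟨τ, B + N * M + Real.log 2, fun n => ?_⟩
  obtain ⟨hne, m, hm, ω, h⟩ := hτ n
  have h1 := abs_le.1 (abs_log_norm_trajectory_sub_le hS hM hne ω m)
  obtain ⟨h2, h3⟩ := hdrift m hm
  rw [abs_le] at h2 h ⊢
  constructor <;> linarith

theorem hasLyapunovExponent_of_abs_log_sub_le {x₀ : EuclideanSpace ℝ (Fin d)}
    {σ : ℕ → Fin K} {l C : ℝ} (hne : ∀ n, trajectory S x₀ σ n ≠ 0)
    (h : ∀ n : ℕ, |Real.log ‖trajectory S x₀ σ n‖ - n * l| ≤ C) :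
    HasLyapunovExponent S x₀ σ l := by
  have hreal : Tendsto (fun n : ℕ => Real.log ‖trajectory S x₀ σ n‖ / n) atTop (𝓝 l) := by
    rw [tendsto_iff_norm_sub_tendsto_zero]
    refine squeeze_zero' (Eventually.of_forall fun _ => norm_nonneg _) ?_
      (tendsto_const_div_atTop_nhds_zero_nat C)
    filter_upwards [eventually_gt_atTop 0] with n hn
    have hn' : (0 : ℝ) < n := by exact_mod_cast hn
    rw [Real.norm_eq_abs, le_div_iff₀ hn', ← abs_of_pos hn', ← abs_mul, abs_of_pos hn', sub_mul,
      div_mul_cancel₀ _ hn'.ne', mul_comm l]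
    exact h n
  refine ((continuous_coe_real_ereal.tendsto l).comp hreal).congr fun n => ?_
  -- The real and extended quotients agree at `n = 0` too, where both are `0`.
  rw [Function.comp_apply, EReal.coe_div, ← ofReal_norm,
    ENNReal.log_ofReal_of_pos (norm_pos_iff.2 (hne n))]
  rfl

end Steering

theorem theorem5p2 (d K : ℕ) (hd : 1 ≤ d) (hK : 2 ≤ K)
    (S : Fin K → Matrix (Fin d) (Fin d) ℝ) (hS : ∀ k, (S k).det ≠ 0)
    (hchaos : ∃ σ : ℕ → Fin K, IsFiberChaotic S σ) :
    (∃ (x₀ : EuclideanSpace ℝ (Fin d)) (σ : ℕ → Fin K) (l : EReal),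
      x₀ ≠ 0 ∧ HasLyapunovExponent S x₀ σ l ∧ 0 < l) ∧
    (∃ (x₀ : EuclideanSpace ℝ (Fin d)) (σ : ℕ → Fin K) (l : EReal),
      x₀ ≠ 0 ∧ HasLyapunovExponent S x₀ σ l ∧ l < 0) ∧
    (∀ x₀ : EuclideanSpace ℝ (Fin d), x₀ ≠ 0 →
      ∃ σ : ℕ → Fin K, HasLyapunovExponent S x₀ σ 0) := by
  obtain ⟨σ, hσ⟩ := hchaos
  obtain ⟨ε, hε, hsteer⟩ := hσ.exists_steering hS
  have hexp (l : ℝ) (hl : |l| ≤ ε) (x₀ : EuclideanSpace ℝ (Fin d)) (hx₀ : x₀ ≠ 0) :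
      ∃ τ : ℕ → Fin K, HasLyapunovExponent S x₀ τ l := by
    obtain ⟨τ, C, h⟩ := hsteer l hl x₀ hx₀
    exact ⟨τ, hasLyapunovExponent_of_abs_log_sub_le (trajectory_ne_zero hS hx₀ τ) h⟩
  have : Nonempty (Fin d) := ⟨⟨0, hd⟩⟩
  obtain ⟨x₁, hx₁⟩ := exists_ne (0 : EuclideanSpace ℝ (Fin d))
  refine ⟨?_, ?_, fun x₀ hx₀ => ?_⟩
  · obtain ⟨τ, h⟩ := hexp ε (abs_of_pos hε).le x₁ hx₁
    exact ⟨x₁, τ, ε, hx₁, h, by exact_mod_cast hε⟩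
  · obtain ⟨τ, h⟩ := hexp (-ε) (by rw [abs_neg, abs_of_pos hε]) x₁ hx₁
    exact ⟨x₁, τ, (-ε : ℝ), hx₁, h, by exact_mod_cast neg_lt_zero.2 hε⟩
  · simpa using hexp 0 (by simpa using hε.le) x₀ hx₀
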